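/- **Theorem 3.2.** Let $m\ge 4$ and $n\ge 5$ be integers, let $P_k$ denote the path on $k$ vertices, and let $P_m\vee P_n$ be the graph obtained from the disjoint union of $P_m$ and $P_n$ by joining every vertex of $P_m$ to every vertex of $P_n$. Define integers by $$p_0=n+3,\quad q_0=0,\quad p_k=(n+2)p_{k-1}+q_{k-1},\quad q_k=1-p_{k-1}\qquad(k\ge 1),$$ $$c_0=m+3,\quad d_0=0,\quad c_k=(m+2)c_{k-1}+d_{k-1},\quad d_k=1-c_{k-1}\qquad(k\ge 1),$$ $$p'_{m-2}=(n+1)p_{m-3}-p_{m-4}+1,\qquad \alpha=1+\sum_{k=0}^{m-3}p_k,\qquad \beta=1+\sum_{k=0}^{n-3}c_k .$$ Then $$p'_{m-2}=\frac{1}{\sqrt{n^2+4n}}\left(\left(\frac{n+2+\sqrt{n^2+4n}}{2}\right)^m-\left(\frac{n+2-\sqrt{n^2+4n}}{2}\right)^m\right),\qquad \alpha=\frac{1}{n}\,p'_{m-2}-\frac{m}{n},$$ $$\beta=\frac{1}{m\sqrt{m^2+4m}}\left(\left(\frac{m+2+\sqrt{m^2+4m}}{2}\right)^n-\left(\frac{m+2-\sqrt{m^2+4m}}{2}\right)^n\right)-\frac{n}{m}.$$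 For a connected graph $G=(V,E)$ with integer Laplacian matrix $L(G)$ and $u,v\in V$, let $\overline{L(G)_{uv}}$ be $L(G)$ with row $u$ and column $v$ removed; the critical group of $G$ is $\mathbb Z^{|V|-1}/\operatorname{im}\overline{L(G)_{uv}}$, where $\operatorname{im}$ is the integer span of the columns. Put $$t=\gcd\left(m\beta+n,\ \alpha\beta-1,\ p'_{m-2}\right),\qquad s=\frac{(m\beta+n)\,p'_{m-2}}{t}.$$ Then, for every choice of the vertices $u,v$, the critical group of $P_m\vee P_n$ is isomorphic to $\mathbb Z/t\mathbb Z\oplus\mathbb Z/s\mathbb Z$, and the number of spanning trees of $P_m\vee P_n$ is $(m\beta+n)\,p'_{m-2}$. -/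

import Mathlib

namespace PathJoin

/-- The join `G ∨ H`: the disjoint union of `G` and `H`, with every vertex of `G` also joined to
every vertex of `H`. -/
def join {V W : Type*} (G : SimpleGraph V) (H : SimpleGraph W) : SimpleGraph (V ⊕ W) where
  Adj
    | Sum.inl u, Sum.inl v => G.Adj u v
    | Sum.inr u, Sum.inr v => H.Adj u v
    | _, _ => True
  symm.symm
    | Sum.inl _, Sum.inl _ => fun h => G.adj_symm h
    | Sum.inr _, Sum.inr _ => fun h => H.adj_symm h
    | Sum.inl _, Sum.inr _ => id
    | Sum.inr _, Sum.inl _ => id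
  loopless := ⟨by rintro (v | v) <;> simp⟩

instance join.decidableAdj {V W : Type*} (G : SimpleGraph V) (H : SimpleGraph W)
    [DecidableRel G.Adj] [DecidableRel H.Adj] : DecidableRel (join G H).Adj
  | Sum.inl u, Sum.inl v => inferInstanceAs (Decidable (G.Adj u v))
  | Sum.inr u, Sum.inr v => inferInstanceAs (Decidable (H.Adj u v))
  | Sum.inl _, Sum.inr _ => inferInstanceAs (Decidable True)
  | Sum.inr _, Sum.inl _ => inferInstanceAs (Decidable True)

instance pathGraph.decidableAdj (n : ℕ) : DecidableRel (SimpleGraph.pathGraph n).Adj :=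
  fun _ _ => decidable_of_iff _ SimpleGraph.pathGraph_adj.symm

/-- The graph `P_m ∨ P_n`. -/
abbrev pathJoin (m n : ℕ) : SimpleGraph (Fin m ⊕ Fin n) :=
  join (SimpleGraph.pathGraph m) (SimpleGraph.pathGraph n)

section CriticalGroup

variable {V : Type*} [Fintype V] [DecidableEq V] (G : SimpleGraph V) [DecidableRel G.Adj]

/-- The integer Laplacian matrix of `G` with row `u` and column `v` struck out. -/
def reducedLaplacian (u v : V) : Matrix {w : V // w ≠ u} {w : V // w ≠ v} ℤ :=
  (G.lapMatrix ℤ).submatrix (fun w => w.1) (fun w => w.1)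

/-- The critical group of `G`, computed with row `u` and column `v` of the Laplacian struck out:
`ℤ^(|V|-1)` modulo the integer span of the columns of the reduced Laplacian. -/
abbrev criticalGroup (u v : V) : Type _ :=
  ({w : V // w ≠ u} → ℤ) ⧸ Submodule.span ℤ (Set.range (reducedLaplacian G u v).col)

end CriticalGroup

/-- The number of spanning trees of `G`. -/
noncomputable def numSpanningTrees {V : Type*} (G : SimpleGraph V) : ℕ :=
  {T : SimpleGraph V | T ≤ G ∧ T.IsTree}.ncard

/-- The pair `(p_k, q_k)` with parameter `a`: `p_0 = a + 3`, `q_0 = 0`,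
`p_k = (a + 2) p_{k-1} + q_{k-1}`, `q_k = 1 - p_{k-1}`. -/
def pairSeq (a : ℕ) : ℕ → ℤ × ℤ
  | 0 => ((a : ℤ) + 3, 0)
  | k + 1 => (((a : ℤ) + 2) * (pairSeq a k).1 + (pairSeq a k).2, 1 - (pairSeq a k).1)

/-- The sequence `p_k` for the parameter `a`. With `a = n` it is `p_k`, with `a = m` it is `c_k`. -/
def pSeq (a k : ℕ) : ℤ := (pairSeq a k).1

/-- The integer `p'_{m-2} = (n + 1) p_{m-3} - p_{m-4} + 1`, meant for `4 ≤ m`. -/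
def pPrime (m n : ℕ) : ℤ := ((n : ℤ) + 1) * pSeq n (m - 3) - pSeq n (m - 4) + 1

/-- The integer `α = 1 + ∑_{k=0}^{m-3} p_k`, meant for `2 ≤ m`. -/
def alpha (m n : ℕ) : ℤ := 1 + ∑ k ∈ Finset.range (m - 2), pSeq n k

/-- The integer `β = 1 + ∑_{k=0}^{n-3} c_k`, meant for `2 ≤ n`. -/
def beta (m n : ℕ) : ℤ := 1 + ∑ k ∈ Finset.range (n - 2), pSeq m k

/-- `t`, the greatest common divisor of `mβ + n`, `αβ - 1` and `p'_{m-2}`. -/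
def tFactor (m n : ℕ) : ℤ :=
  Int.gcd (Int.gcd (m * beta m n + n) (alpha m n * beta m n - 1)) (pPrime m n)

/-- `s = (mβ + n) p'_{m-2} / t`; the division is exact, since `t` divides `p'_{m-2}`. -/
def sFactor (m n : ℕ) : ℤ := (m * beta m n + n) * pPrime m n / tFactor m n

end PathJoin

open SimpleGraph Matrix

namespace PathJoin

/-! ### The matrix-tree theorem, via rooted parent functions. -/

section MatrixTree

variable {V : Type*}

/-! Homomorphisms from the critical group to an abelian group `M` correspond to `M`-valued harmonic
functions on the vertices, up to constants. Ground such a function at the first vertex of `P_m`. In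
the join each path sees the other only through the sum of its values, so along each path harmonicity
is an inhomogeneous second-order recurrence, solved by Lucas numbers (`eq_pathSol_of_pathLap`).
Everything is then determined by the sum `Y` over `P_n` and the first value `b` there, subject
exactly to `P Y = 0` and `(αβ - 1) Y + Q b = 0`, where `P = p'_{m-2} = lucasU n m` and `Q = mβ + n =
lucasU m n` (`relations_of_isHarmonic`, `isHarmonic_of_relations`). The invariant factors of this 2
× 2 presentation are the gcd of its entries and its determinant divided by that gcd
(`exists_generators_of_relations`).

Spanning trees are counted by the order of the group: their number is the determinant of the reduced
Laplacian (`det_reducedLaplacian`), whose absolute value is the order of the cokernel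
(`natAbs_det_eq_card_quotient`). -/

/-- A parent function `f` on the non-root vertices is graded if some height function drops along
each step; equivalently, iterating `f` always leads to the root. -/
def Graded {r : V} (f : {w : V // w ≠ r} → V) : Prop :=
  ∃ d : V → ℕ, ∀ i, d (f i) < d i.1

/-- The graph whose edges join each non-root vertex to its parent. -/
def parentGraph {r : V} (f : {w : V // w ≠ r} → V) : SimpleGraph V :=
  SimpleGraph.fromRel fun a b => ∃ h : a ≠ r, f ⟨a, h⟩ = b

lemma Graded.ne {r : V} {f : {w : V // w ≠ r} → V} (hf : Graded f) (i) : i.1 ≠ f i := by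
  obtain ⟨d, hd⟩ := hf
  intro h
  have := hd i
  rw [← h] at this
  exact lt_irrefl _ this

lemma Graded.adj {r : V} {f : {w : V // w ≠ r} → V} (hf : Graded f) (i) :
    (parentGraph f).Adj i.1 (f i) :=
  (SimpleGraph.fromRel_adj _ _ _).2 ⟨hf.ne i, Or.inl ⟨i.2, rfl⟩⟩

lemma Graded.exists_path {r : V} {f : {w : V // w ≠ r} → V} (hf : Graded f) (v : V) :
    ∃ p : (parentGraph f).Walk v r, p.IsPath ∧ ∀ h : v ≠ r, p.snd = f ⟨v, h⟩ := by
  obtain ⟨d, hd⟩ := id hf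
  suffices H : ∀ n, ∀ v, d v = n → ∃ p : (parentGraph f).Walk v r, p.IsPath ∧
      (∀ w ∈ p.support, d w ≤ d v) ∧ ∀ h : v ≠ r, p.snd = f ⟨v, h⟩ by
    obtain ⟨p, hp, -, h⟩ := H _ v rfl
    exact ⟨p, hp, h⟩
  intro n
  induction n using Nat.strong_induction_on with
  | _ n ih =>
    intro v hv
    by_cases h : v = r
    · subst h
      exact ⟨.nil, by simp, by simp, fun h => absurd rfl h⟩
    · have hlt := hd ⟨v, h⟩
      obtain ⟨p, hp, hs, -⟩ := ih (d (f ⟨v, h⟩)) (hv ▸ hlt) _ rfl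
      refine ⟨.cons (hf.adj ⟨v, h⟩) p, ?_, ?_, fun _ => by simp⟩
      · rw [Walk.cons_isPath_iff]
        exact ⟨hp, fun hm => absurd (hs _ hm) (not_le.2 hlt)⟩
      · intro w hw
        rw [Walk.support_cons, List.mem_cons] at hw
        rcases hw with rfl | hw
        · exact le_rfl
        · exact (hs w hw).trans hlt.le

lemma Graded.connected {r : V} {f : {w : V // w ≠ r} → V} (hf : Graded f) :
    (parentGraph f).Connected := by
  have h : ∀ v, (parentGraph f).Reachable v r := fun v => (hf.exists_path v).elim fun p _ => ⟨p⟩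
  have : Nonempty V := ⟨r⟩
  exact ⟨fun a b => (h a).trans (h b).symm⟩

lemma Graded.isTree [Finite V] {r : V} {f : {w : V // w ≠ r} → V} (hf : Graded f) :
    (parentGraph f).IsTree := by
  rw [isTree_iff_connected_and_card]
  refine ⟨hf.connected, le_antisymm ?_ hf.connected.card_vert_le_card_edgeSet_add_one⟩
  -- Each edge joins some non-root vertex to its parent, which bounds the number of edges.
  have h1 : Nat.card (parentGraph f).edgeSet ≤ Nat.card {w : V // w ≠ r} := by
    refine Nat.card_le_card_of_surjective
      (fun i => (⟨s(i.1, f i), hf.adj i⟩ : (parentGraph f).edgeSet)) ?_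
    rintro ⟨e, he⟩
    induction e using Sym2.ind with
    | _ a b =>
      obtain ⟨-, ⟨h, rfl⟩ | ⟨h, rfl⟩⟩ := (SimpleGraph.fromRel_adj _ _ _).1 ((mem_edgeSet _).1 he)
      · exact ⟨⟨a, h⟩, rfl⟩
      · exact ⟨⟨b, h⟩, Subtype.ext Sym2.eq_swap⟩
  have h2 : Nat.card {w : V // w ≠ r} < Nat.card V := by
    classical
    have := Fintype.ofFinite V
    rw [Nat.card_eq_fintype_card, Nat.card_eq_fintype_card]
    exact Fintype.card_subtype_lt (x := r) (by simp)
  omega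

/-- The parent of a vertex is the second vertex on its unique path to the root. -/
lemma parentGraph_injOn [Finite V] {r : V} {f g : {w : V // w ≠ r} → V} (hf : Graded f)
    (hg : Graded g) (h : parentGraph f = parentGraph g) : f = g := by
  funext i
  obtain ⟨p, hp, hps⟩ := hf.exists_path i.1
  obtain ⟨q, hq, hqs⟩ := hg.exists_path i.1
  rw [← hps i.2, ← hqs i.2]
  revert p
  rw [h]
  intro p hp hps
  rw [(hg.isTree.existsUnique_path i.1 r).unique hp hq]

lemma exists_graded_of_isTree [Finite V] {T : SimpleGraph V} (hT : T.IsTree) (r : V) :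
    ∃ f : {w : V // w ≠ r} → V, Graded f ∧ parentGraph f = T := by
  choose p hp using fun v => (hT.existsUnique_path v r).exists
  have hadj : ∀ i : {w : V // w ≠ r}, T.Adj i.1 (p i.1).snd := fun i =>
    (p i.1).adj_snd (Walk.not_nil_of_ne i.2)
  have hf : Graded (fun i : {w : V // w ≠ r} => (p i.1).snd) := by
    refine ⟨fun v => (p v).length, fun i => ?_⟩
    have hnil : ¬ (p i.1).Nil := Walk.not_nil_of_ne i.2
    have h1 : p (p i.1).snd = (p i.1).tail :=
      (hT.existsUnique_path _ r).unique (hp _) (hp i.1).tail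
    have h2 := Walk.length_tail_add_one hnil
    simp only [h1]
    omega
  refine ⟨_, hf, ?_⟩
  refine le_antisymm ?_ ?_
  · intro a b hab
    obtain ⟨-, ⟨h, rfl⟩ | ⟨h, rfl⟩⟩ := (SimpleGraph.fromRel_adj _ _ _).1 hab
    · exact hadj ⟨a, h⟩
    · exact (hadj ⟨b, h⟩).symm
  -- A tree is minimal among connected graphs, so a connected subgraph on all its vertices is the
  -- whole tree.
  · refine (isTree_iff_minimal_connected.1 hT).2 hf.connected ?_
    intro a b hab
    obtain ⟨-, ⟨h, rfl⟩ | ⟨h, rfl⟩⟩ := (SimpleGraph.fromRel_adj _ _ _).1 hab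
    · exact hadj ⟨a, h⟩
    · exact (hadj ⟨b, h⟩).symm

lemma numSpanningTrees_eq_card [Finite V] (G : SimpleGraph V) (r : V) :
    numSpanningTrees G =
      {f : {w : V // w ≠ r} → V | (∀ i, G.Adj i.1 (f i)) ∧ Graded f}.ncard := by
  have himg : {T : SimpleGraph V | T ≤ G ∧ T.IsTree} =
      parentGraph '' {f : {w : V // w ≠ r} → V | (∀ i, G.Adj i.1 (f i)) ∧ Graded f} := by
    ext T
    constructor
    · rintro ⟨hle, hT⟩
      obtain ⟨f, hf, rfl⟩ := exists_graded_of_isTree hT r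
      exact ⟨f, ⟨fun i => hle (hf.adj i), hf⟩, rfl⟩
    · rintro ⟨f, ⟨hadj, hf⟩, rfl⟩
      refine ⟨?_, hf.isTree⟩
      intro a b hab
      obtain ⟨-, ⟨h, rfl⟩ | ⟨h, rfl⟩⟩ := (SimpleGraph.fromRel_adj _ _ _).1 hab
      · exact hadj ⟨a, h⟩
      · exact (hadj ⟨b, h⟩).symm
  rw [numSpanningTrees, himg, Set.InjOn.ncard_image]
  rintro f ⟨-, hf⟩ g ⟨-, hg⟩ h
  exact parentGraph_injOn hf hg h

variable [DecidableEq V]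

/-- The matrix with rows `e_i - e_{f i}`, where the coordinate of the root is dropped. -/
def parentMatrix {r : V} (f : {w : V // w ≠ r} → V) :
    Matrix {w : V // w ≠ r} {w : V // w ≠ r} ℤ :=
  Matrix.of fun i k => (if k = i then 1 else 0) - if k.1 = f i then 1 else 0

/-- The matrix is unitriangular for the height: a permutation with nonzero product never lowers `d`
from `i` to `σ i`, and since the total of `d` is preserved it must be the identity. -/
lemma det_parentMatrix_of_graded [Fintype V] {r : V} {f : {w : V // w ≠ r} → V}
    (hf : Graded f) : (parentMatrix f).det = 1 := by
  obtain ⟨d, hd⟩ := id hf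
  have hdiag : ∀ i, parentMatrix f i i = 1 := fun i => by simp [parentMatrix, hf.ne i]
  have hoff : ∀ i k, parentMatrix f i k ≠ 0 → k = i ∨ d k.1 < d i.1 := by
    intro i k h
    by_cases hki : k = i
    · exact Or.inl hki
    · right
      by_cases hk : k.1 = f i
      · rw [hk]; exact hd i
      · simp [parentMatrix, hki, hk] at h
  rw [Matrix.det_apply, Finset.sum_eq_single 1]
  · simp [hdiag]
  · intro σ _ hσ
    by_contra hne
    have hprod : ∀ i, parentMatrix f (σ i) i ≠ 0 := by
      intro i hi
      have h0 : ∏ j, parentMatrix f (σ j) j = 0 := Finset.prod_eq_zero (Finset.mem_univ i) hi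
      exact hne (by rw [h0, smul_zero])
    have hle : ∀ i ∈ Finset.univ, d (i : {w : V // w ≠ r}).1 ≤ d (σ i).1 := fun i _ => by
      rcases hoff _ _ (hprod i) with h | h
      · rw [← h]
      · exact h.le
    have hsum : ∑ i : {w : V // w ≠ r}, d i.1 = ∑ i, d (σ i).1 :=
      (Equiv.sum_comp σ (fun i : {w : V // w ≠ r} => d i.1)).symm
    have heq := (Finset.sum_eq_sum_iff_of_le hle).1 hsum
    refine hσ (Equiv.ext fun i => ?_)
    rcases hoff _ _ (hprod i) with h | h
    · exact h.symm
    · exact absurd (heq i (Finset.mem_univ i)) h.ne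
  · simp

/-- The indicator of the vertices that never reach the root is a nonzero kernel vector. If there
were none, the number of steps to the root would be a height function. -/
lemma det_parentMatrix_of_not_graded [Fintype V] {r : V} {f : {w : V // w ≠ r} → V}
    (hf : ¬ Graded f) : (parentMatrix f).det = 0 := by
  classical
  set step : V → V := fun v => if h : v ≠ r then f ⟨v, h⟩ else r with hstep
  have hstep' : ∀ i : {w : V // w ≠ r}, step i.1 = f i := fun i => by simp [hstep, i.2]
  set R : V → Prop := fun v => ∃ k, step^[k] v = r with hR
  have hRstep : ∀ i : {w : V // w ≠ r}, R (f i) ↔ R i.1 := by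
    intro i
    rw [← hstep' i]
    constructor
    · rintro ⟨k, hk⟩
      exact ⟨k + 1, hk⟩
    · rintro ⟨_ | k, hk⟩
      · exact absurd hk i.2
      · exact ⟨k, hk⟩
  have hex : ∃ v, ¬ R v := by
    by_contra! hall
    refine hf ⟨fun v => Nat.find (hall v), fun i => ?_⟩
    have hspec := Nat.find_spec (hall i.1)
    have hpos : Nat.find (hall i.1) ≠ 0 := fun h0 => by
      rw [h0] at hspec
      exact i.2 hspec
    obtain ⟨k, hk⟩ := Nat.exists_eq_succ_of_ne_zero hpos
    rw [hk, Function.iterate_succ_apply, hstep'] at hspec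
    show Nat.find (hall (f i)) < Nat.find (hall i.1)
    rw [hk]
    exact Nat.lt_succ_of_le (Nat.find_min' _ hspec)
  obtain ⟨v, hv⟩ := hex
  have hvr : v ≠ r := fun h => hv ⟨0, h⟩
  refine Matrix.exists_mulVec_eq_zero_iff.1
    ⟨fun i => if R i.1 then 0 else 1, fun h => ?_, ?_⟩
  · have := congrFun h ⟨v, hvr⟩
    simp [hv] at this
  · funext i
    have hsum : ∀ g : {w : V // w ≠ r} → ℤ,
        ∑ k, (if k.1 = f i then g k else 0) = if h : f i ≠ r then g ⟨f i, h⟩ else 0 := by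
      intro g
      split_ifs with h
      · rw [Finset.sum_eq_single ⟨f i, h⟩]
        · simp
        · intro b _ hb
          rw [if_neg fun hb' => hb (Subtype.ext hb')]
        · simp
      · refine Finset.sum_eq_zero fun k _ => if_neg fun hk => h (fun hr => k.2 (hk.trans hr))
    have hr : R r := ⟨0, rfl⟩
    simp only [Matrix.mulVec, dotProduct, parentMatrix, Matrix.of_apply, sub_mul, ite_mul, one_mul, zero_mul,
      Finset.sum_sub_distrib, Finset.sum_ite_eq', Finset.mem_univ, if_true,
      Pi.zero_apply]
    rw [hsum (fun k => if R k.1 then 0 else 1)]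
    by_cases h : f i = r
    · have : R i.1 := (hRstep i).1 (h ▸ hr)
      simp [h, this]
    · simp [h, hRstep i]

variable [Fintype V]

lemma reducedLaplacian_apply_eq_sum (G : SimpleGraph V) [DecidableRel G.Adj] (r : V)
    (i : {w : V // w ≠ r}) :
    reducedLaplacian G r r i = ∑ j, (if G.Adj i.1 j then (1 : ℤ) else 0) •
      fun k : {w : V // w ≠ r} => (if k = i then (1 : ℤ) else 0) - if k.1 = j then 1 else 0 := by
  funext k
  simp only [reducedLaplacian, Matrix.submatrix_apply, lapMatrix, degMatrix, Matrix.sub_apply,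
    Matrix.diagonal_apply, adjMatrix_apply, Finset.sum_apply, Pi.smul_apply, smul_eq_mul, mul_sub,
    Finset.sum_sub_distrib, mul_ite, mul_one, mul_zero, Finset.sum_ite_eq, Finset.mem_univ,
    if_true]
  congr 1
  by_cases h : k = i
  · subst h
    simp [← card_neighborFinset_eq_degree, neighborFinset_eq_filter]
  · rw [if_neg fun h' => h (Subtype.ext h'.symm)]
    simp [h]

/-- The **matrix-tree theorem**. -/
theorem det_reducedLaplacian (G : SimpleGraph V) [DecidableRel G.Adj] (r : V) :
    (reducedLaplacian G r r).det = numSpanningTrees G := by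
  classical
  have h1 : (reducedLaplacian G r r).det = ∑ f : {w : V // w ≠ r} → V,
      (∏ i, if G.Adj i.1 (f i) then (1 : ℤ) else 0) * (parentMatrix f).det := by
    have h2 : reducedLaplacian G r r = fun i => ∑ j, (if G.Adj i.1 j then (1 : ℤ) else 0) •
      fun k : {w : V // w ≠ r} => (if k = i then (1 : ℤ) else 0) - if k.1 = j then 1 else 0 :=
      funext (reducedLaplacian_apply_eq_sum G r)
    rw [h2]
    -- Multilinearity in the rows: expanding chooses one neighbour, the parent, for each non-root
    -- vertex.
    refine (MultilinearMap.map_sum Matrix.detRowAlternating.toMultilinearMap _).trans ?_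
    refine Finset.sum_congr rfl fun f _ => ?_
    exact MultilinearMap.map_smul_univ Matrix.detRowAlternating.toMultilinearMap
      (fun i => if G.Adj i.1 (f i) then (1 : ℤ) else 0) (parentMatrix f)
  rw [h1, numSpanningTrees_eq_card G r, Set.ncard_eq_toFinset_card', Finset.card_eq_sum_ones,
    Nat.cast_sum, Set.toFinset_ofPred, Finset.sum_filter]
  refine Finset.sum_congr rfl fun f _ => ?_
  by_cases hg : Graded f
  · rw [det_parentMatrix_of_graded hg, mul_one, Finset.prod_boole]
    simp [hg]
  · simp [det_parentMatrix_of_not_graded hg, hg]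

end MatrixTree

/-! ### Lucas sequences and the closed forms. -/

section Recurrence

/-- The Lucas sequence `U` of parameters `a + 2` and `1`. -/
def lucasU (a : ℕ) : ℕ → ℤ
  | 0 => 0
  | 1 => 1
  | k + 2 => ((a : ℤ) + 2) * lucasU a (k + 1) - lucasU a k

/-- The partial sums `U_1 + ⋯ + U_k` of `lucasU`. -/
def lucasSum (a k : ℕ) : ℤ := ∑ i ∈ Finset.range k, lucasU a (i + 1)

lemma lucasU_add_two (a k : ℕ) :
    lucasU a (k + 2) = ((a : ℤ) + 2) * lucasU a (k + 1) - lucasU a k := rfl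

lemma lucasSum_succ (a k : ℕ) : lucasSum a (k + 1) = lucasSum a k + lucasU a (k + 1) :=
  Finset.sum_range_succ _ _

lemma mul_lucasSum (a k : ℕ) : (a : ℤ) * lucasSum a k = lucasU a (k + 1) - lucasU a k - 1 := by
  induction k with
  | zero => simp [lucasSum, lucasU]
  | succ k ih => rw [lucasSum_succ, mul_add, ih, lucasU_add_two]; ring

lemma lucasSum_add_two (a k : ℕ) :
    lucasSum a (k + 2) = ((a : ℤ) + 2) * lucasSum a (k + 1) - lucasSum a k + 1 := by
  have := mul_lucasSum a (k + 1)
  rw [lucasSum_succ a (k + 1), lucasU_add_two]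
  rw [lucasU_add_two] at this
  linear_combination -this - lucasSum_succ a k

lemma pSeq_add_two (a k : ℕ) :
    pSeq a (k + 2) = ((a : ℤ) + 2) * pSeq a (k + 1) + (1 - pSeq a k) := rfl

lemma pSeq_eq (a k : ℕ) : pSeq a k = lucasSum a (k + 2) := by
  induction k using Nat.twoStepInduction with
  | zero => simp [pSeq, pairSeq, lucasSum, lucasU, Finset.sum_range_succ]; ring
  | one => simp [pSeq, pairSeq, lucasSum, lucasU, Finset.sum_range_succ]; ring
  | more k ih1 ih2 => rw [pSeq_add_two, ih1, ih2, lucasSum_add_two a (k + 2)]; ring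

lemma pPrime_eq {m : ℕ} (n : ℕ) (hm : 4 ≤ m) : pPrime m n = lucasU n m := by
  obtain ⟨k, rfl⟩ := Nat.exists_eq_add_of_le' hm
  rw [pPrime, show k + 4 - 3 = k + 1 by omega, show k + 4 - 4 = k by omega, pSeq_eq, pSeq_eq]
  linear_combination lucasSum_succ n (k + 3) - lucasSum_add_two n (k + 2)

/-- As `p_i` is `lucasSum a (i + 2)`, the leading 1 supplies the two missing terms, 0 and 1. -/
lemma one_add_sum_pSeq (a : ℕ) {k : ℕ} (hk : 2 ≤ k) :
    1 + ∑ i ∈ Finset.range (k - 2), pSeq a i = ∑ j ∈ Finset.range k, lucasSum a j := by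
  obtain ⟨k, rfl⟩ := Nat.exists_eq_add_of_le' hk
  have h0 : lucasSum a 0 = 0 := rfl
  have h1 : lucasSum a 1 = 1 := by simp [lucasSum, lucasU]
  rw [Finset.sum_range_succ', Finset.sum_range_succ', Nat.add_sub_cancel, h0, zero_add, h1,
    add_zero, add_comm]
  simp only [pSeq_eq]

lemma mul_sum_lucasSum (a k : ℕ) :
    (a : ℤ) * ∑ j ∈ Finset.range k, lucasSum a j = lucasU a k - k := by
  induction k with
  | zero => simp [lucasU]
  | succ k ih =>
    rw [Finset.sum_range_succ, mul_add, ih, mul_lucasSum]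
    push_cast
    ring

lemma alpha_eq {m : ℕ} (n : ℕ) (hm : 2 ≤ m) :
    alpha m n = ∑ j ∈ Finset.range m, lucasSum n j := one_add_sum_pSeq n hm

lemma beta_eq (m : ℕ) {n : ℕ} (hn : 2 ≤ n) :
    beta m n = ∑ j ∈ Finset.range n, lucasSum m j := one_add_sum_pSeq m hn

lemma mul_alpha {m : ℕ} (n : ℕ) (hm : 2 ≤ m) : (n : ℤ) * alpha m n = lucasU n m - m := by
  rw [alpha_eq n hm, mul_sum_lucasSum]

lemma mul_beta (m : ℕ) {n : ℕ} (hn : 2 ≤ n) : (m : ℤ) * beta m n = lucasU m n - n := by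
  rw [beta_eq m hn, mul_sum_lucasSum]

lemma lucasU_nonneg_and_lt (a k : ℕ) : 0 ≤ lucasU a k ∧ lucasU a k < lucasU a (k + 1) := by
  induction k with
  | zero => simp [lucasU]
  | succ k ih =>
    obtain ⟨h0, h1⟩ := ih
    refine ⟨h0.trans h1.le, ?_⟩
    rw [lucasU_add_two]
    have : (0 : ℤ) ≤ a * lucasU a (k + 1) := mul_nonneg (by positivity) (h0.trans h1.le)
    linarith

lemma lucasU_pos (a : ℕ) {k : ℕ} (hk : 0 < k) : 0 < lucasU a k := by
  obtain ⟨k, rfl⟩ := Nat.exists_eq_succ_of_ne_zero hk.ne'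
  exact (lucasU_nonneg_and_lt a k).1.trans_lt (lucasU_nonneg_and_lt a k).2

lemma sqrt_mul_lucasU (a k : ℕ) :
    √((a : ℝ) ^ 2 + 4 * a) * (lucasU a k : ℝ) =
      (((a : ℝ) + 2 + √((a : ℝ) ^ 2 + 4 * a)) / 2) ^ k -
        (((a : ℝ) + 2 - √((a : ℝ) ^ 2 + 4 * a)) / 2) ^ k := by
  have hs : √((a : ℝ) ^ 2 + 4 * a) ^ 2 = (a : ℝ) ^ 2 + 4 * a := Real.sq_sqrt (by positivity)
  set s := √((a : ℝ) ^ 2 + 4 * a)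
  induction k using Nat.twoStepInduction with
  | zero => simp [lucasU]
  | one => simp [lucasU]; ring
  | more k ih1 ih2 =>
    rw [lucasU_add_two]
    push_cast
    have h1 : (((a : ℝ) + 2 + s) / 2) ^ 2 = (a + 2) * ((a + 2 + s) / 2) - 1 := by
      linear_combination hs / 4
    have h2 : (((a : ℝ) + 2 - s) / 2) ^ 2 = (a + 2) * ((a + 2 - s) / 2) - 1 := by
      linear_combination hs / 4
    rw [pow_add _ k 2, pow_add _ k 2, h1, h2]
    rw [pow_succ, pow_succ] at ih2
    linear_combination ((a : ℝ) + 2) * ih2 - ih1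

lemma lucasU_eq {a : ℕ} (ha : 0 < a) (k : ℕ) :
    (lucasU a k : ℝ) = 1 / √((a : ℝ) ^ 2 + 4 * a) *
      ((((a : ℝ) + 2 + √((a : ℝ) ^ 2 + 4 * a)) / 2) ^ k -
        (((a : ℝ) + 2 - √((a : ℝ) ^ 2 + 4 * a)) / 2) ^ k) := by
  rw [← sqrt_mul_lucasU]
  have : √((a : ℝ) ^ 2 + 4 * a) ≠ 0 := by positivity
  field_simp

end Recurrence

/-! ### The Laplacian recurrence along a path. -/

section PathSystem

variable {M : Type*} [AddCommGroup M]

/-- The Laplacian of the path on `0, …, m - 1` applied to the sequence `w`, at the vertex `i`. -/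
def pathLap (m : ℕ) (w : ℕ → M) (i : ℕ) : M :=
  (if i + 1 < m then w i - w (i + 1) else 0) + if 0 < i then w i - w (i - 1) else 0

/-- The solution of `x (i + 2) = (a + 2) x (i + 1) - x i - c` with `x 1 - x 0 = a x 0 - c`. -/
def pathSol (a : ℕ) (x c : M) (i : ℕ) : M :=
  (lucasU a (i + 1) - lucasU a i) • x - lucasSum a i • c

lemma pathSol_zero (a : ℕ) (x c : M) : pathSol a x c 0 = x := by
  simp [pathSol, lucasU, lucasSum]

lemma pathSol_one (a : ℕ) (x c : M) : pathSol a x c 1 = ((a : ℤ) + 1) • x - c := by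
  simp only [pathSol, lucasU, lucasSum, Finset.sum_range_one]
  module

lemma pathSol_add_two (a : ℕ) (x c : M) (i : ℕ) :
    pathSol a x c (i + 2) = ((a : ℤ) + 2) • pathSol a x c (i + 1) - pathSol a x c i - c := by
  simp only [pathSol, lucasSum_add_two, lucasU_add_two]
  module

lemma pathSol_succ_sub (a : ℕ) (x c : M) (i : ℕ) :
    pathSol a x c (i + 1) - pathSol a x c i = lucasU a (i + 1) • ((a : ℤ) • x - c) := by
  simp only [pathSol, lucasSum_succ, lucasU_add_two]
  module

lemma sum_pathSol (a : ℕ) (x c : M) (k : ℕ) :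
    ∑ i ∈ Finset.range k, pathSol a x c i =
      lucasU a k • x - (∑ j ∈ Finset.range k, lucasSum a j) • c := by
  simp only [pathSol, Finset.sum_sub_distrib, ← Finset.sum_smul,
    Finset.sum_range_sub (lucasU a), show lucasU a 0 = 0 from rfl, sub_zero]

lemma pathLap_pathSol {m : ℕ} (hm : 2 ≤ m) (a : ℕ) {x c : M}
    (h : lucasU a m • ((a : ℤ) • x - c) = 0) {i : ℕ} (hi : i < m) :
    pathLap m (pathSol a x c) i + (a : ℤ) • pathSol a x c i = c := by
  obtain _ | i := i
  · simp only [pathLap, zero_add, if_pos (show 1 < m by omega), lt_irrefl, if_false, add_zero,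
      pathSol_zero, pathSol_one]
    module
  · by_cases him : i + 1 + 1 < m
    · simp only [pathLap, if_pos him, Nat.succ_pos, if_true, Nat.add_sub_cancel, pathSol_add_two]
      module
    · obtain rfl : m = i + 2 := by omega
      rw [← pathSol_succ_sub, pathSol_add_two] at h
      simp only [pathLap, if_neg him, Nat.succ_pos, if_true, Nat.add_sub_cancel]
      rw [← sub_eq_zero, zero_add, ← h]
      module

/-- All vertices but the last determine the sequence from `w 0`. The last one says that the
recurrence, continued one step, repeats its value; consecutive differences are Lucas multiples of `a
• w 0 - c`. -/
lemma eq_pathSol_of_pathLap {m : ℕ} (hm : 2 ≤ m) (a : ℕ) {w : ℕ → M} {c : M}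
    (h : ∀ i < m, pathLap m w i + (a : ℤ) • w i = c) :
    (∀ i < m, w i = pathSol a (w 0) c i) ∧ lucasU a m • ((a : ℤ) • w 0 - c) = 0 := by
  have h1 : ∀ i < m, w i = pathSol a (w 0) c i := by
    intro i
    induction i using Nat.twoStepInduction with
    | zero => intro _; rw [pathSol_zero]
    | one =>
      intro h1
      have h0 := h 0 (by omega)
      simp only [pathLap, zero_add, if_pos h1, lt_irrefl, if_false, add_zero] at h0
      rw [pathSol_one, ← h0]
      module
    | more k ih1 ih2 =>
      intro hk
      have h0 := h (k + 1) (by omega)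
      simp only [pathLap, if_pos hk, Nat.succ_pos, if_true, Nat.add_sub_cancel] at h0
      rw [pathSol_add_two, ← ih1 (by omega), ← ih2 (by omega), ← h0]
      module
  refine ⟨h1, ?_⟩
  obtain ⟨k, rfl⟩ := Nat.exists_eq_add_of_le' hm
  have h0 := h (k + 1) (by omega)
  simp only [pathLap, lt_irrefl, if_false, Nat.succ_pos, if_true, Nat.add_sub_cancel,
    zero_add] at h0
  rw [← pathSol_succ_sub, pathSol_add_two, ← h1 k (by omega), ← h1 (k + 1) (by omega), ← h0]
  module

end PathSystem

/-! ### Universal property of the critical group. -/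

section Harmonic

variable {V : Type*} [Fintype V] [DecidableEq V] (G : SimpleGraph V) [DecidableRel G.Adj]
  {M : Type*} [AddCommGroup M]

/-- A function on the vertices with values in an abelian group is harmonic if the Laplacian
annihilates it. -/
def IsHarmonic (x : V → M) : Prop := ∀ i, ∑ j, G.lapMatrix ℤ i j • x j = 0

lemma sum_lapMatrix_smul (x : V → M) (i : V) :
    ∑ j, G.lapMatrix ℤ i j • x j = ∑ j, if G.Adj i j then x i - x j else 0 := by
  have h : ∑ j, (if G.Adj i j then x i else 0) = (G.degree i : ℤ) • x i := by
    rw [← Finset.sum_filter, Finset.sum_const, ← card_neighborFinset_eq_degree,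
      neighborFinset_eq_filter, natCast_zsmul]
  simp only [lapMatrix, degMatrix, Matrix.sub_apply, Matrix.diagonal_apply, adjMatrix_apply,
    sub_smul, ite_smul, zero_smul, one_smul, Finset.sum_sub_distrib, Finset.sum_ite_eq,
    Finset.mem_univ, if_true]
  rw [← h, ← Finset.sum_sub_distrib]
  refine Finset.sum_congr rfl fun j _ => ?_
  split_ifs <;> simp

lemma isHarmonic_iff (x : V → M) :
    IsHarmonic G x ↔ ∀ i, ∑ j, (if G.Adj i j then x i - x j else 0) = 0 := by
  simp only [IsHarmonic, sum_lapMatrix_smul]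

variable {G} in
lemma IsHarmonic.sub_const {x : V → M} (hx : IsHarmonic G x) (c : M) :
    IsHarmonic G fun w => x w - c := by
  rw [isHarmonic_iff] at hx ⊢
  simpa using hx

lemma sum_lapMatrix_left (j : V) : ∑ i, G.lapMatrix ℤ i j = 0 := by
  have h := congrFun (G.lapMatrix_mulVec_const_eq_zero (R := ℤ)) j
  simp only [Matrix.mulVec, dotProduct, mul_one, Pi.zero_apply] at h
  rw [← h]
  exact Finset.sum_congr rfl fun i _ => (G.isSymm_lapMatrix (R := ℤ)).apply j i

/-- The class of a vertex in the critical group, which is zero for the grounded vertex `u`. -/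
def vertexClass (u v w : V) : criticalGroup G u v :=
  Submodule.Quotient.mk fun i => if i.1 = w then 1 else 0

lemma vertexClass_self (u v : V) : vertexClass G u v u = 0 := by
  rw [vertexClass, Submodule.Quotient.mk_eq_zero]
  convert Submodule.zero_mem _ using 1
  funext i
  exact if_neg i.2

/-- By symmetry of the Laplacian, the equation at `i` says that column `i` vanishes in the quotient.
The struck-out column `v` is no exception, because all the equations sum to zero. -/
lemma isHarmonic_vertexClass (u v : V) : IsHarmonic G (vertexClass G u v) := by
  have hcol : ∀ i, ∑ j, G.lapMatrix ℤ i j • vertexClass G u v j =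
      Submodule.Quotient.mk fun k : {w : V // w ≠ u} => G.lapMatrix ℤ k.1 i := by
    intro i
    have h : (fun k : {w : V // w ≠ u} => G.lapMatrix ℤ k.1 i) =
        ∑ j, G.lapMatrix ℤ i j • fun k : {w : V // w ≠ u} => if k.1 = j then (1 : ℤ) else 0 := by
      funext k
      simp [Finset.sum_apply, (G.isSymm_lapMatrix (R := ℤ)).apply i k.1]
    rw [h, ← Submodule.mkQ_apply, map_sum]
    rfl
  have hne : ∀ i, i ≠ v → ∑ j, G.lapMatrix ℤ i j • vertexClass G u v j = 0 := by
    intro i hi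
    rw [hcol, Submodule.Quotient.mk_eq_zero]
    exact Submodule.subset_span ⟨⟨i, hi⟩, rfl⟩
  intro i
  by_cases hi : i = v
  · have htot : ∑ i, ∑ j, G.lapMatrix ℤ i j • vertexClass G u v j = 0 := by
      rw [Finset.sum_comm]
      simp [← Finset.sum_smul, sum_lapMatrix_left]
    rw [← htot]
    exact (Finset.sum_eq_single i (fun j _ hj => hne j (hi ▸ hj)) (by simp)).symm
  · exact hne i hi

lemma criticalGroup_hom_ext {u v : V} {f g : criticalGroup G u v →+ M}
    (h : ∀ w, f (vertexClass G u v w) = g (vertexClass G u v w)) : f = g := by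
  have h1 : f.toIntLinearMap = g.toIntLinearMap := by
    refine Submodule.linearMap_qext _ (LinearMap.pi_ext' fun w => LinearMap.ext_ring ?_)
    have h2 := h w.1
    have h3 : (fun i : {w : V // w ≠ u} => if i.1 = w.1 then (1 : ℤ) else 0) = Pi.single w 1 := by
      funext i
      simp [Pi.single_apply, Subtype.ext_iff]
    rw [vertexClass, h3] at h2
    exact h2
  exact AddMonoidHom.ext fun x => LinearMap.congr_fun h1 x

variable {G} in
/-- A harmonic function `h` induces a homomorphism from the critical group, given by `h - h u`. -/
lemma IsHarmonic.exists_hom {h : V → M} (hh : IsHarmonic G h) (u v : V) :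
    ∃ f : criticalGroup G u v →+ M, ∀ w, f (vertexClass G u v w) = h w - h u := by
  let φ : ({w : V // w ≠ u} → ℤ) →ₗ[ℤ] M := Fintype.linearCombination ℤ fun w => h w.1 - h u
  have hsum : ∀ x : V → ℤ, φ (fun k => x k.1) = ∑ j, x j • (h j - h u) := by
    intro x
    rw [Fintype.linearCombination_apply, ← Fintype.sum_subtype_add_sum_subtype (fun j => j ≠ u)]
    rw [Finset.sum_eq_zero (s := Finset.univ)
      (f := fun i : {x // ¬ x ≠ u} => x i.1 • (h i.1 - h u)), add_zero]
    rintro ⟨i, hi⟩ -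
    simp [not_not.1 hi]
  have hφ : Submodule.span ℤ (Set.range (reducedLaplacian G u v).col) ≤ LinearMap.ker φ := by
    rw [Submodule.span_le]
    rintro _ ⟨j, rfl⟩
    have h1 := hh.sub_const (h u) j.1
    simp only [fun k => (G.isSymm_lapMatrix (R := ℤ)).apply k j.1] at h1
    exact (hsum fun k => G.lapMatrix ℤ k j.1).trans h1
  refine ⟨((Submodule.span ℤ (Set.range (reducedLaplacian G u v).col)).liftQ φ hφ).toAddMonoidHom,
    fun w => ?_⟩
  refine (hsum fun k => if k = w then 1 else 0).trans ?_
  simp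

variable {G} in
/-- The critical group is the universal recipient of differences of a harmonic function. -/
theorem IsHarmonic.criticalGroup_equiv {h : V → M} (hh : IsHarmonic G h) {u v : V}
    (f : M →+ criticalGroup G u v)
    (hf : ∀ w, f (h w - h u) = vertexClass G u v w)
    (hgen : ∀ f : M →+ M, (∀ w, f (h w - h u) = h w - h u) → f = AddMonoidHom.id M) :
    Nonempty (criticalGroup G u v ≃+ M) := by
  obtain ⟨g, hg⟩ := hh.exists_hom u v
  exact ⟨AddMonoidHom.toAddEquiv g f
    (criticalGroup_hom_ext G fun w => by simp [hg, hf])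
    (hgen _ fun w => by simp [hg, hf])⟩

end Harmonic

/-! ### Order of the critical group. -/

section Determinant

lemma natAbs_det_eq_card_quotient {ι : Type*} [Fintype ι] [DecidableEq ι] (A : Matrix ι ι ℤ)
    (hA : A.det ≠ 0) :
    A.det.natAbs = Nat.card ((ι → ℤ) ⧸ Submodule.span ℤ (Set.range A.col)) := by
  have hinj : Function.Injective A.mulVecLin := by
    rw [← LinearMap.ker_eq_bot, LinearMap.ker_eq_bot']
    intro x hx
    exact Matrix.eq_zero_of_mulVec_eq_zero hA hx
  rw [← Matrix.range_mulVecLin]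
  have h := Submodule.natAbs_det_equiv (LinearMap.range A.mulVecLin)
    (LinearEquiv.ofInjective A.mulVecLin hinj)
  rw [← h]
  congr 1
  rw [← LinearMap.det_toLin']
  rfl

lemma numSpanningTrees_eq_card_criticalGroup {V : Type*} [Fintype V] [DecidableEq V]
    {G : SimpleGraph V} [DecidableRel G.Adj] (hG : G.Connected) (r : V) :
    numSpanningTrees G = Nat.card (criticalGroup G r r) := by
  have h0 : numSpanningTrees G ≠ 0 := by
    obtain ⟨T, hle, hT⟩ := hG.exists_isTree_le
    exact Set.ncard_ne_zero_of_mem (a := T) ⟨hle, hT⟩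
  have hdet := det_reducedLaplacian G r
  have h := natAbs_det_eq_card_quotient (reducedLaplacian G r r)
    (by rw [hdet]; exact_mod_cast h0)
  rw [← h, hdet, Int.natAbs_natCast]

end Determinant

/-! ### Smith normal form of a triangular 2 × 2 presentation. -/

section TwoGenerators

lemma Int.exists_isCoprime_add_mul {a b c : ℤ} (hc : c ≠ 0)
    (h : ∀ p : ℤ, Prime p → p ∣ a → p ∣ b → ¬ p ∣ c) : ∃ k, IsCoprime (a + k * b) c := by
  classical
  -- With this `k`, a prime factor of `c` divides exactly one of `a` and `k`; one dividing `a` does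
  -- not divide `b`.
  refine ⟨∏ p ∈ c.natAbs.primeFactors.filter (fun p : ℕ => ¬ (p : ℤ) ∣ a), (p : ℤ), ?_⟩
  refine isCoprime_of_prime_dvd (fun h => hc h.2) ?_
  intro p hp hpa hpc
  by_cases ha : p ∣ a
  · rcases hp.dvd_or_dvd ((Int.dvd_add_right ha).1 hpa) with hk | hb
    · obtain ⟨q, hq, hpq⟩ := (Prime.dvd_finsetProd_iff hp _).1 hk
      rw [Finset.mem_filter, Nat.mem_primeFactors] at hq
      exact hq.2 (((hp.dvd_prime_iff_associated (Nat.prime_iff_prime_int.1 hq.1.1)).1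
        hpq).symm.dvd.trans ha)
    · exact h p hp ha hb hpc
  · refine ha ((Int.dvd_add_left (Dvd.dvd.mul_right ?_ b)).1 hpa)
    rw [← Int.natAbs_dvd]
    refine Finset.dvd_prod_of_mem (fun p : ℕ => (p : ℤ)) (Finset.mem_filter.2 ⟨?_, ?_⟩)
    · exact Nat.mem_primeFactors.2 ⟨Int.prime_iff_natAbs_prime.1 hp, Int.natAbs_dvd_natAbs.2 hpc,
        Int.natAbs_ne_zero.2 hc⟩
    · rwa [Int.natAbs_dvd]

lemma zsmul_mk_one (d p : ℤ) :
    p • ((1 : ℤ) : ℤ ⧸ AddSubgroup.zmultiples d) = (p : ℤ ⧸ AddSubgroup.zmultiples d) := by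
  rw [← QuotientAddGroup.mk_zsmul, smul_eq_mul, mul_one]

lemma zsmul_mk_one_self (d : ℤ) : d • ((1 : ℤ) : ℤ ⧸ AddSubgroup.zmultiples d) = 0 := by
  rw [zsmul_mk_one, QuotientAddGroup.eq_zero_iff]
  exact AddSubgroup.mem_zmultiples d

lemma exists_hom_of_zsmul_eq_zero {K : Type*} [AddCommGroup K] {d : ℤ} {x : K} (hx : d • x = 0) :
    ∃ f : ℤ ⧸ AddSubgroup.zmultiples d →+ K, f (1 : ℤ) = x := by
  refine ⟨QuotientAddGroup.lift _ (zmultiplesHom K x) ?_, ?_⟩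
  · rintro _ ⟨k, rfl⟩
    simp [mul_smul, hx]
  · exact (QuotientAddGroup.lift_mk _ _ _).trans (by simp)

/-- The abelian group on two generators `x, y` with relations `P x = 0` and `c x + Q y = 0`. -/
lemma exists_generators_of_relations {P Q c t s : ℤ} (hP : P ≠ 0) (hQ : Q ≠ 0) (ht : t ≠ 0)
    (htP : t ∣ P) (htQ : t ∣ Q) (htc : t ∣ c) (hgcd : ∀ d, d ∣ P → d ∣ Q → d ∣ c → d ∣ t)
    (hts : t * s = Q * P) :
    ∃ x y : (ℤ ⧸ AddSubgroup.zmultiples t) × (ℤ ⧸ AddSubgroup.zmultiples s),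
      P • x = 0 ∧ c • x + Q • y = 0 ∧
      (∀ g : (ℤ ⧸ AddSubgroup.zmultiples t) × (ℤ ⧸ AddSubgroup.zmultiples s) →+
          (ℤ ⧸ AddSubgroup.zmultiples t) × (ℤ ⧸ AddSubgroup.zmultiples s),
        g x = x → g y = y → g = AddMonoidHom.id _) ∧
      ∀ {K : Type} [AddCommGroup K] (x' y' : K), P • x' = 0 → c • x' + Q • y' = 0 →
        ∃ f : (ℤ ⧸ AddSubgroup.zmultiples t) × (ℤ ⧸ AddSubgroup.zmultiples s) →+ K,
          f x = x' ∧ f y = y' := by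
  obtain ⟨P', rfl⟩ := htP
  obtain ⟨b, rfl⟩ := htQ
  obtain ⟨c', rfl⟩ := htc
  obtain rfl : s = t * b * P' := mul_left_cancel₀ ht (by rw [hts]; ring)
  obtain ⟨k, u, v, huv⟩ := Int.exists_isCoprime_add_mul (a := c') (b := P') (c := b)
    (by rintro rfl; simp at hQ) (fun p hp hc hP' hb => by
      have h := hgcd (t * p) (mul_dvd_mul_left _ hP') (mul_dvd_mul_left _ hb)
        (mul_dvd_mul_left _ hc)
      exact hp.not_isUnit (isUnit_of_dvd_one ((mul_dvd_mul_iff_left ht).1 (by simpa using h))))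
  obtain ⟨a, rfl⟩ : ∃ a, c' = a - k * P' := ⟨c' + k * P', by ring⟩
  rw [sub_add_cancel] at huv
  let T := ℤ ⧸ AddSubgroup.zmultiples t
  let S := ℤ ⧸ AddSubgroup.zmultiples (t * b * P')
  let e : T × S := (((1 : ℤ) : T), 0)
  let e' : T × S := (0, ((1 : ℤ) : S))
  have he : t • e = 0 := Prod.ext (zsmul_mk_one_self t) (smul_zero _)
  have he' : (t * b * P') • e' = 0 := Prod.ext (smul_zero _) (zsmul_mk_one_self _)
  have hspan : ∀ z : T × S, ∃ p q : ℤ, z = p • e + q • e' := by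
    rintro ⟨x, y⟩
    obtain ⟨p, rfl⟩ := QuotientAddGroup.mk_surjective x
    obtain ⟨q, rfl⟩ := QuotientAddGroup.mk_surjective y
    exact ⟨p, q, Prod.ext (by simp [e, e', ← zsmul_mk_one t p]) (by simp [e, e', ← zsmul_mk_one _ q])⟩
  -- Since `u a + v b = 1`, this change of generators is unimodular, with inverse `e = a x + b y`,
  -- `e' = u y - v x`.
  refine ⟨u • e - b • e', v • e + a • e', ?_, ?_, ?_, ?_⟩
  · linear_combination (norm := module) (P' * u) • he - he'
  · linear_combination (norm := module) (a * u - k * P' * u + b * v) • he + k • he'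
  · intro g hx hy
    have h1 : a • (u • e - b • e') + b • (v • e + a • e') = e := by
      linear_combination (norm := module) huv • e
    have h2 : u • (v • e + a • e') - v • (u • e - b • e') = e' := by
      linear_combination (norm := module) huv • e'
    have h3 : g e = e := by
      rw [← h1, map_add, map_zsmul, map_zsmul, hx, hy]
    have h4 : g e' = e' := by
      rw [← h2, map_sub, map_zsmul, map_zsmul, hx, hy]
    ext z : 1
    obtain ⟨p, q, rfl⟩ := hspan z
    simp [h3, h4]
  · intro K _ x' y' h1 h2
    obtain ⟨f, hf⟩ := exists_hom_of_zsmul_eq_zero (d := t) (x := a • x' + b • y') (by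
      linear_combination (norm := module) h2 + k • h1)
    obtain ⟨f', hf'⟩ := exists_hom_of_zsmul_eq_zero (d := t * b * P') (x := u • y' - v • x') (by
      linear_combination (norm := module) (P' * u) • h2 - (u * (a - k * P') + v * b) • h1)
    have h3 : f.coprod f' e = a • x' + b • y' := by simp [e, hf]
    have h4 : f.coprod f' e' = u • y' - v • x' := by simp [e', hf']
    refine ⟨f.coprod f', ?_, ?_⟩
    · rw [map_sub, map_zsmul, map_zsmul, h3, h4]
      linear_combination (norm := module) huv • x'
    · rw [map_add, map_zsmul, map_zsmul, h3, h4]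
      linear_combination (norm := module) huv • y'

end TwoGenerators

/-! ### Harmonic functions on the join of two paths. -/

section PathJoin

variable {M : Type*} [AddCommGroup M]

lemma sum_pathGraph_adj {m : ℕ} (w : ℕ → M) (i : Fin m) :
    ∑ j : Fin m, (if (pathGraph m).Adj i j then w i - w j else 0) = pathLap m w i := by
  have h : ∀ j : Fin m, (if (pathGraph m).Adj i j then w i - w j else 0) =
      (if i.1 + 1 = j.1 then w i - w (i + 1) else 0) +
        if i.1 - 1 = j.1 then (if 0 < i.1 then w i - w (i - 1) else 0) else 0 := by
    intro j
    simp only [pathGraph_adj]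
    by_cases h1 : i.1 + 1 = j.1
    · rw [if_pos (Or.inl h1), if_pos h1, if_neg (show ¬ i.1 - 1 = j.1 by omega), add_zero, h1]
    · by_cases h2 : j.1 + 1 = i.1
      · rw [if_pos (Or.inr h2), if_neg h1, if_pos (show i.1 - 1 = j.1 by omega),
          if_pos (show 0 < i.1 by omega), zero_add, show i.1 - 1 = j.1 by omega]
      · rw [if_neg (not_or.2 ⟨h1, h2⟩), if_neg h1, zero_add]
        split_ifs with h3 h4
        · omega
        · rfl
        · rfl
  rw [Finset.sum_congr rfl fun j _ => h j, Finset.sum_add_distrib, pathLap]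
  congr 1
  · rw [Fin.sum_univ_eq_sum_range (fun j => if i.1 + 1 = j then w i - w (i + 1) else 0) m]
    simp
  · rw [Fin.sum_univ_eq_sum_range
      (fun j => if i.1 - 1 = j then (if 0 < i.1 then w i - w (i - 1) else 0) else 0) m]
    have : i.1 - 1 < m := by omega
    simp [this]

lemma isHarmonic_pathJoin_iff {m n : ℕ} (x y : ℕ → M) :
    IsHarmonic (pathJoin m n) (Sum.elim (fun i => x i.1) (fun j => y j.1) : Fin m ⊕ Fin n → M) ↔
      (∀ i < m, pathLap m x i + (n : ℤ) • x i = ∑ j ∈ Finset.range n, y j) ∧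
      (∀ j < n, pathLap n y j + (m : ℤ) • y j = ∑ i ∈ Finset.range m, x i) := by
  have h1 : ∀ i : Fin m, ∑ j : Fin m ⊕ Fin n, (if (pathJoin m n).Adj (.inl i) j then
      (Sum.elim (fun i => x i.1) (fun j => y j.1) (.inl i : Fin m ⊕ Fin n) : M) -
        Sum.elim (fun i => x i.1) (fun j => y j.1) j else 0) =
      pathLap m x i + (n : ℤ) • x i - ∑ j ∈ Finset.range n, y j := by
    intro i
    rw [Fintype.sum_sum_type, ← sum_pathGraph_adj, ← Fin.sum_univ_eq_sum_range, add_sub_assoc]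
    congr 1
    simp [pathJoin, join]
  have h2 : ∀ i : Fin n, ∑ j : Fin m ⊕ Fin n, (if (pathJoin m n).Adj (.inr i) j then
      (Sum.elim (fun i => x i.1) (fun j => y j.1) (.inr i : Fin m ⊕ Fin n) : M) -
        Sum.elim (fun i => x i.1) (fun j => y j.1) j else 0) =
      pathLap n y i + (m : ℤ) • y i - ∑ j ∈ Finset.range m, x j := by
    intro i
    rw [Fintype.sum_sum_type, ← sum_pathGraph_adj, ← Fin.sum_univ_eq_sum_range, add_sub_assoc]
    refine (add_comm _ _).trans (congrArg₂ _ ?_ ?_)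
    · exact Finset.sum_congr rfl fun j _ => if_congr Iff.rfl rfl rfl
    · simp [pathJoin, join]
  rw [isHarmonic_iff, Sum.forall]
  simp only [h1, h2, sub_eq_zero, Fin.forall_iff]

lemma relations_of_isHarmonic {m n : ℕ} (hm : 2 ≤ m) (hn : 2 ≤ n) {x y : ℕ → M} (h0 : x 0 = 0)
    (h : IsHarmonic (pathJoin m n)
      (Sum.elim (fun i => x i.1) (fun j => y j.1) : Fin m ⊕ Fin n → M)) :
    lucasU n m • ∑ j ∈ Finset.range n, y j = 0 ∧
    (alpha m n * beta m n - 1) • ∑ j ∈ Finset.range n, y j + lucasU m n • y 0 = 0 ∧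
    (∀ i < m, x i = pathSol n 0 (∑ j ∈ Finset.range n, y j) i) ∧
    ∀ j < n, y j = pathSol m (y 0) (-(alpha m n • ∑ j ∈ Finset.range n, y j)) j := by
  rw [isHarmonic_pathJoin_iff] at h
  obtain ⟨h1, h2⟩ := eq_pathSol_of_pathLap hm n h.1
  obtain ⟨h3, -⟩ := eq_pathSol_of_pathLap hn m h.2
  set Y := ∑ j ∈ Finset.range n, y j with hY
  have hX : ∑ i ∈ Finset.range m, x i = -(alpha m n • Y) := by
    rw [Finset.sum_congr rfl fun i hi => h1 i (Finset.mem_range.1 hi), sum_pathSol, h0, smul_zero,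
      zero_sub, alpha_eq n hm]
  rw [hX] at h3
  rw [h0] at h1 h2
  refine ⟨?_, ?_, h1, h3⟩
  · linear_combination (norm := module) -h2
  -- The second relation is self-consistency: summing the solution along `P_n` must return `Y`.
  · have h4 : Y = lucasU m n • y 0 - beta m n • -(alpha m n • Y) := by
      conv_lhs => rw [hY]
      rw [Finset.sum_congr rfl fun i hi => h3 i (Finset.mem_range.1 hi), sum_pathSol,
        ← beta_eq m hn]
    linear_combination (norm := module) -h4

lemma isHarmonic_of_relations {m n : ℕ} (hm : 2 ≤ m) (hn : 2 ≤ n) {Y b : M}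
    (h1 : lucasU n m • Y = 0)
    (h2 : (alpha m n * beta m n - 1) • Y + lucasU m n • b = 0) :
    IsHarmonic (pathJoin m n) (Sum.elim (fun i => pathSol n 0 Y i.1)
      (fun j => pathSol m b (-(alpha m n • Y)) j.1) : Fin m ⊕ Fin n → M) ∧
    ∑ j ∈ Finset.range n, pathSol m b (-(alpha m n • Y)) j = Y := by
  have hY : ∑ j ∈ Finset.range n, pathSol m b (-(alpha m n • Y)) j = Y := by
    rw [sum_pathSol, ← beta_eq m hn]
    linear_combination (norm := module) h2
  refine ⟨(isHarmonic_pathJoin_iff _ _).2 ⟨fun i hi => ?_, fun j hj => ?_⟩, hY⟩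
  · rw [hY]
    refine pathLap_pathSol hm n ?_ hi
    linear_combination (norm := module) -h1
  · rw [sum_pathSol, ← alpha_eq n hm, smul_zero, zero_sub]
    refine pathLap_pathSol hn m ?_ hj
    have hα := mul_alpha n hm
    have hβ := mul_beta m hn
    obtain hP : lucasU n m = n * alpha m n + m := by linarith
    obtain hQ : lucasU m n = m * beta m n + n := by linarith
    rw [hP] at h1
    rw [hQ] at h2 ⊢
    -- The end condition on `P_n` imposes no third relation.
    linear_combination (norm := module) (m : ℤ) • h2 + h1

theorem criticalGroup_pathJoin {m n : ℕ} (hm : 2 ≤ m) (hn : 2 ≤ n) {t s : ℤ} (ht : t ≠ 0)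
    (htP : t ∣ lucasU n m) (htQ : t ∣ lucasU m n) (htc : t ∣ alpha m n * beta m n - 1)
    (hgcd : ∀ d, d ∣ lucasU n m → d ∣ lucasU m n → d ∣ alpha m n * beta m n - 1 → d ∣ t)
    (hts : t * s = lucasU m n * lucasU n m) (u v : Fin m ⊕ Fin n) :
    Nonempty (criticalGroup (pathJoin m n) u v ≃+
      (ℤ ⧸ AddSubgroup.zmultiples t) × (ℤ ⧸ AddSubgroup.zmultiples s)) := by
  obtain ⟨Y, b, h1, h2, hid, hlift⟩ := exists_generators_of_relations
    (lucasU_pos n (by omega : 0 < m)).ne' (lucasU_pos m (by omega : 0 < n)).ne' ht htP htQ htc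
    hgcd hts
  obtain ⟨hh, hY⟩ := isHarmonic_of_relations hm hn h1 h2
  have hm0 : 0 < m := by omega
  have hn0 : 0 < n := by omega
  let c := vertexClass (pathJoin m n) u v
  let x : ℕ → criticalGroup (pathJoin m n) u v := fun i =>
    if h : i < m then c (.inl ⟨i, h⟩) - c (.inl ⟨0, hm0⟩) else 0
  let y : ℕ → criticalGroup (pathJoin m n) u v := fun j =>
    if h : j < n then c (.inr ⟨j, h⟩) - c (.inl ⟨0, hm0⟩) else 0
  have hxy : (Sum.elim (fun i => x i.1) (fun j => y j.1) : Fin m ⊕ Fin n → _) =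
      fun w => c w - c (.inl ⟨0, hm0⟩) := by
    funext w
    rcases w with i | j
    · simp [x]
    · simp [y]
  have hharm := (isHarmonic_vertexClass (pathJoin m n) u v).sub_const (c (.inl ⟨0, hm0⟩))
  rw [← hxy] at hharm
  obtain ⟨r1, r2, r3, r4⟩ := relations_of_isHarmonic hm hn (by simp [x]) hharm
  obtain ⟨f, hfY, hfb⟩ := hlift _ _ r1 r2
  have hf : ∀ w, f ((Sum.elim (fun i => pathSol n 0 Y i.1)
      (fun j => pathSol m b (-(alpha m n • Y)) j.1) : Fin m ⊕ Fin n → _) w) =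
      c w - c (.inl ⟨0, hm0⟩) := by
    intro w
    rw [← congrFun hxy w]
    rcases w with i | j
    · simp [r3 i.1 i.2, pathSol, hfY]
    · simp only [Sum.elim_inr]
      rw [r4 j.1 j.2]
      simp [pathSol, hfY, hfb]
  refine hh.criticalGroup_equiv f (fun w => ?_) fun g hg => ?_
  · rw [map_sub, hf, hf, sub_sub_sub_cancel_right,
      show c u = 0 from vertexClass_self _ _ _, sub_zero]
  -- The grounding vertex need not be `u`; subtracting its equation removes the value at `u`.
  · have hg' : ∀ j (hj : j < n), g (pathSol m b (-(alpha m n • Y)) j) =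
        pathSol m b (-(alpha m n • Y)) j := by
      intro j hj
      have e1 := hg (.inr ⟨j, hj⟩)
      have e2 := hg (.inl ⟨0, hm0⟩)
      simp only [Sum.elim_inl, Sum.elim_inr, pathSol_zero, map_sub, zero_sub, map_neg] at e1 e2
      rw [neg_inj] at e2
      rwa [e2, sub_left_inj] at e1
    refine hid g ?_ ?_
    · rw [← hY, map_sum]
      exact Finset.sum_congr rfl fun j hj => hg' j (Finset.mem_range.1 hj)
    · have := hg' 0 hn0
      rwa [pathSol_zero] at this

lemma pathJoin_connected {m n : ℕ} (hm : 0 < m) (hn : 0 < n) : (pathJoin m n).Connected := by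
  have h : ∀ i j, (pathJoin m n).Adj (.inl i) (.inr j) := fun _ _ => trivial
  have h0 : ∀ w, (pathJoin m n).Reachable w (.inl ⟨0, hm⟩) := by
    rintro (i | j)
    · exact (h i ⟨0, hn⟩).reachable.trans (h _ _).symm.reachable
    · exact (h _ j).symm.reachable
  have : Nonempty (Fin m ⊕ Fin n) := ⟨.inl ⟨0, hm⟩⟩
  exact ⟨fun a b => (h0 a).trans (h0 b).symm⟩

end PathJoin

end PathJoin

/-! ### Assembly of the theorem. -/

theorem theorem3p2 (m n : ℕ) (hm : 4 ≤ m) (hn : 5 ≤ n) :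
    -- closed forms of the three integers `p'_{m-2}`, `α`, `β`
    ((PathJoin.pPrime m n : ℝ) =
        1 / √((n : ℝ) ^ 2 + 4 * n) *
          ((((n : ℝ) + 2 + √((n : ℝ) ^ 2 + 4 * n)) / 2) ^ m -
            (((n : ℝ) + 2 - √((n : ℝ) ^ 2 + 4 * n)) / 2) ^ m)) ∧
    ((PathJoin.alpha m n : ℝ) = 1 / (n : ℝ) * (PathJoin.pPrime m n : ℝ) - (m : ℝ) / n) ∧
    ((PathJoin.beta m n : ℝ) =
        1 / ((m : ℝ) * √((m : ℝ) ^ 2 + 4 * m)) *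
          ((((m : ℝ) + 2 + √((m : ℝ) ^ 2 + 4 * m)) / 2) ^ n -
            (((m : ℝ) + 2 - √((m : ℝ) ^ 2 + 4 * m)) / 2) ^ n) - (n : ℝ) / m) ∧
    -- the critical group is `ℤ/tℤ ⊕ ℤ/sℤ`, whichever row and column are struck out
    (∀ u v : Fin m ⊕ Fin n,
      Nonempty (PathJoin.criticalGroup (PathJoin.pathJoin m n) u v ≃+
        (ℤ ⧸ AddSubgroup.zmultiples (PathJoin.tFactor m n)) ×
          (ℤ ⧸ AddSubgroup.zmultiples (PathJoin.sFactor m n)))) ∧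
    -- the number of spanning trees
    ((PathJoin.numSpanningTrees (PathJoin.pathJoin m n) : ℤ) =
      (m * PathJoin.beta m n + n) * PathJoin.pPrime m n) := by
  have hβ := PathJoin.mul_beta m (by omega : 2 ≤ n)
  have hα := PathJoin.mul_alpha n (by omega : 2 ≤ m)
  have hP := PathJoin.pPrime_eq n hm
  have hQ : m * PathJoin.beta m n + n = PathJoin.lucasU m n := by linarith
  have hPpos := PathJoin.lucasU_pos n (by omega : 0 < m)
  have hQpos := PathJoin.lucasU_pos m (by omega : 0 < n)
  have hm0 : (m : ℝ) ≠ 0 := by positivity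
  have hn0 : (n : ℝ) ≠ 0 := by positivity
  have ht : PathJoin.tFactor m n = Int.gcd (Int.gcd (PathJoin.lucasU m n)
      (PathJoin.alpha m n * PathJoin.beta m n - 1)) (PathJoin.lucasU n m) := by
    rw [PathJoin.tFactor, hQ, hP]
  have htP : PathJoin.tFactor m n ∣ PathJoin.lucasU n m := ht ▸ Int.gcd_dvd_right ..
  have htg := ht ▸ Int.gcd_dvd_left (Int.gcd (PathJoin.lucasU m n)
      (PathJoin.alpha m n * PathJoin.beta m n - 1)) (PathJoin.lucasU n m)
  have ht0 : PathJoin.tFactor m n ≠ 0 := fun h => hPpos.ne' (zero_dvd_iff.1 (h ▸ htP))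
  have hts : PathJoin.tFactor m n * PathJoin.sFactor m n =
      PathJoin.lucasU m n * PathJoin.lucasU n m := by
    rw [PathJoin.sFactor, hQ, hP]
    exact Int.mul_ediv_cancel' (htP.mul_left _)
  have hcrit : ∀ u v : Fin m ⊕ Fin n,
      Nonempty (PathJoin.criticalGroup (PathJoin.pathJoin m n) u v ≃+
        (ℤ ⧸ AddSubgroup.zmultiples (PathJoin.tFactor m n)) ×
          (ℤ ⧸ AddSubgroup.zmultiples (PathJoin.sFactor m n))) := by
    refine PathJoin.criticalGroup_pathJoin (by omega) (by omega) ht0 htP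
      (htg.trans (Int.gcd_dvd_left ..)) (htg.trans (Int.gcd_dvd_right ..)) ?_ hts
    intro d h1 h2 h3
    rw [ht]
    exact Int.dvd_coe_gcd (Int.dvd_coe_gcd h2 h3) h1
  refine ⟨?_, ?_, ?_, hcrit, ?_⟩
  · rw [hP, PathJoin.lucasU_eq (by omega)]
  · rw [hP]
    have : (n : ℝ) * PathJoin.alpha m n = PathJoin.lucasU n m - m := by exact_mod_cast hα
    field_simp
    linarith
  · have h1 : (m : ℝ) * PathJoin.beta m n = PathJoin.lucasU m n - n := by exact_mod_cast hβ
    have h2 := PathJoin.lucasU_eq (by omega : 0 < m) n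
    rw [one_div, mul_inv, mul_assoc, ← one_div (√_), ← h2]
    field_simp
    linarith
  · have hconn := PathJoin.pathJoin_connected (by omega : 0 < m) (by omega : 0 < n)
    let r : Fin m ⊕ Fin n := .inl ⟨0, by omega⟩
    obtain ⟨e⟩ := hcrit r r
    have hcard : ∀ d : ℤ, Nat.card (ℤ ⧸ AddSubgroup.zmultiples d) = d.natAbs := fun d => by
      rw [← Int.index_zmultiples]; rfl
    rw [PathJoin.numSpanningTrees_eq_card_criticalGroup hconn r, Nat.card_congr e.toEquiv,
      Nat.card_prod, hcard, hcard, ← Int.natAbs_mul, hts, hQ, hP]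
    exact Int.natAbs_of_nonneg (mul_nonneg hQpos.le hPpos.le)
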